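/- Proposition (Hierarchy of regularity conditions, convex case). Let $\mathbb X,\mathbb Y$ be finite-dimensional real Hilbert spaces, let $f:\mathbb X\to\overline{\mathbb R}$ be proper, lower semicontinuous and convex, let $A:\mathbb X\to\mathbb Y$ be linear and surjective with adjoint $A^*$, let $b\in\mathbb Y$, and put $$\mathcal E=\{x\in\mathbb X: Ax=b\},\qquad f_{\mathcal E}=f+\delta_{\mathcal E},\qquad \mathcal F=\mathcal E\cap\operatorname{dom} f .$$ Here $\delta_{\mathcal E}$ is $0$ on $\mathcal E$ and $+\infty$ elsewhere, and $\operatorname{dom} f=\{x: f(x)<+\infty\}$. Notation. For a function $g$ finite at $x$: a regular subgradient of $g$ at $x$ is a $v$ with $g(z)\ge g(x)+\langle v,z-x\rangle+o(\|z-x\|)$. The set $\partial g(x)$ consists of all limits of regular subgradients $v_k$ of $g$ at points $x_k$ with $x_k\to x$, $g(x_k)\to g(x)$. The set $\partial^\infty g(x)$ consists of all limits of $\lambda_k v_k$ with such $x_k,v_k$ and $\lambda_k>0$, $\lambda_k\to0$. The subderivative is $\mathrm d g(x)(w)=\liminf_{\tau\downarrow0,\,w'\to w}\frac{g(x+\tau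 w')-g(x)}{\tau}$. The epigraph is $\operatorname{epi} g=\{(x,\tau)\in\mathbb X\times\mathbb R: g(x)\le\tau\}$. For a closed set $S$ and $\bar x\in S$: a regular normal to $S$ at $\bar x$ is a $d$ with $\langle d,z-\bar x\rangle\le o(\|z-\bar x\|)$ for $z\in S$. The normal cone $\mathcal N_S(\bar x)$ consists of all limits of regular normals $d_k$ to $S$ at points $x_k\in S$ with $x_k\to\bar x$. The tangent cone is $\mathcal T_S(\bar x)=\{d:\operatorname{dist}(\bar x+td,S)=o(t)\text{ as } t\downarrow0\}$. Further, $\mathcal T_f(x)=\{v:\exists h\in\mathbb R,\ (v,h)\in\mathcal T_{\operatorname{epi} f}(x,f(x))\}$, and $\operatorname{lin} S$ is the largest linear subspace contained in $S$. For $x\in\mathcal F$ consider the following conditions. 1. (SSR) $\partial f_{\mathcal E}(x)=\partial f(x)+A^*\mathbb Y$. 2. (R-SSR) $\partial f_{\mathcal E}(x)=\partial f(x)+A^*\mathbb Y$ and $\partial^\infty f_{\mathcal E}(x)=\partial^\infty f(x)+A^*\mathbb Y$. 3. (epi-CHIP) $\mathcal N_{\operatorname{epi} f_{\mathcal E}}(x,f(x))=\mathcal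 N_{\operatorname{epi} f}(x,f(x))+\mathcal N_{\mathcal E\times\mathbb R}(x,f(x))$. 4. (Epigraphical transversality) $\mathcal N_{\operatorname{epi} f}(x,f(x))\cap\mathcal N_{\mathcal E\times\mathbb R}(x,f(x))=\{0\}$. 5. (Horizon qualification condition) $\partial^\infty f(x)\cap A^*\mathbb Y=\{0\}$. 6. (Robinson constraint qualification) $\mathcal T_f(x)+\ker A=\mathbb X$. 7. (Robinson constraint nondegeneracy) $\operatorname{lin}\mathcal T_f(x)+\ker A=\mathbb X$. Then, at every $x\in\mathcal F$, $$(1)\Longleftarrow\big[(2)\Longleftrightarrow(3)\big]\Longleftarrow\big[(4)\Longleftrightarrow(5)\Longleftrightarrow(6)\big]\Longleftarrow(7).$$ Moreover, (4) is equivalent to $\mathcal T_{\operatorname{epi} f}(x,f(x))+\mathcal T_{\mathcal E\times\mathbb R}(x,f(x))=\mathbb X\times\mathbb R$, (6) is equivalent to $A\,\mathcal T_f(x)=\mathbb Y$, (7) is equivalent to $A(\operatorname{lin}\mathcal T_f(x))=\mathbb Y$, and $\mathcal T_f(x)=\operatorname{dom}\mathrm d f(x)$. -/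

import Mathlib

open Filter Topology Asymptotics
open scoped Pointwise

noncomputable section

namespace RegHierarchy

section General

variable {H : Type*} [NormedAddCommGroup H] [InnerProductSpace ℝ H]

/-- The regular (Fréchet) normal cone to `S` at `x`: all `d` with
`⟪d, z - x⟫ ≤ o(‖z - x‖)` for `z ∈ S`; empty when `x ∉ S`. -/
def regularNormalCone (S : Set H) (x : H) : Set H :=
  {d | x ∈ S ∧ ∀ ε : ℝ, 0 < ε → ∀ᶠ z in 𝓝[S] x, inner ℝ d (z - x) ≤ ε * ‖z - x‖}

/-- The limiting normal cone to `S` at `x`: the outer limit of the regular normal cones. -/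
def normalCone (S : Set H) (x : H) : Set H :=
  {d | x ∈ S ∧ ∃ (u : ℕ → H) (w : ℕ → H), Tendsto u atTop (𝓝 x) ∧ Tendsto w atTop (𝓝 d) ∧
    ∀ k, w k ∈ regularNormalCone S (u k)}

/-- The tangent cone to `S` at `x ∈ S`: all `d` with `dist (x + t d, S) = o(t)`, `t ↓ 0`. -/
def tangentCone (S : Set H) (x : H) : Set H :=
  {d | x ∈ S ∧ (fun t : ℝ => Metric.infDist (x + t • d) S) =o[𝓝[>] (0 : ℝ)] (fun t : ℝ => t)}

/-- The largest linear subspace contained in `S`, as the supremum of all linear subspaces contained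
in `S` (for a nonempty convex cone `S` this supremum is itself contained in `S`, see
`lin_isGreatest`). -/
def lin (S : Set H) : Submodule ℝ H := sSup {L : Submodule ℝ H | (L : Set H) ⊆ S}

theorem lin_isGreatest (S : Set H) (h0 : (0 : H) ∈ S) (hadd : ∀ a ∈ S, ∀ b ∈ S, a + b ∈ S) :
    IsGreatest {L : Submodule ℝ H | (L : Set H) ⊆ S} (lin S) := by
  refine ⟨fun v hv => ?_, fun L hL => le_sSup hL⟩
  have hv' : v ∈ sSup {L : Submodule ℝ H | (L : Set H) ⊆ S} := hv
  rw [sSup_eq_iSup'] at hv'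
  exact Submodule.iSup_induction (motive := fun v => v ∈ S) _ hv'
    (fun L a ha => L.2 ha) h0 (fun a b ha hb => hadd a ha b hb)

/-- The effective domain. -/
def effDom (f : H → EReal) : Set H := {x | f x < ⊤}

/-- The epigraph, in the Hilbert space `H × ℝ` (with its Euclidean product structure). -/
def epi (f : H → EReal) : Set (WithLp 2 (H × ℝ)) := {p | f p.fst ≤ (p.snd : EReal)}

/-- Proper: never `-∞`, and not identically `+∞`. -/
def IsProper (f : H → EReal) : Prop := (∀ x, f x ≠ ⊥) ∧ ∃ x, f x ≠ ⊤

/-- Extended-real-valued convexity: the epigraph is convex. -/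
def IsConvexFun (f : H → EReal) : Prop := Convex ℝ (epi f)

/-- The regular (Fréchet) subgradients of `f` at `x` (a point where `f` is finite):
`f z ≥ f x + ⟪v, z - x⟫ + o(‖z - x‖)`. -/
def regularSubdiff (f : H → EReal) (x : H) : Set H :=
  {v | f x ≠ ⊥ ∧ f x ≠ ⊤ ∧ ∀ ε : ℝ, 0 < ε → ∀ᶠ z in 𝓝 x,
    f x + ((inner ℝ v (z - x) - ε * ‖z - x‖ : ℝ) : EReal) ≤ f z}

/-- The (limiting) subgradients of `f` at `x` (a point where `f` is finite): limits of regular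
subgradients at points `u k → x` with `f (u k) → f x`. -/
def subdiff (f : H → EReal) (x : H) : Set H :=
  {v | f x ≠ ⊥ ∧ f x ≠ ⊤ ∧ ∃ (u : ℕ → H) (w : ℕ → H), Tendsto u atTop (𝓝 x) ∧
    Tendsto (fun k => f (u k)) atTop (𝓝 (f x)) ∧ (∀ k, w k ∈ regularSubdiff f (u k)) ∧
    Tendsto w atTop (𝓝 v)}

/-- The horizon subgradients of `f` at `x` (a point where `f` is finite): limits of `l k • w k`
with `l k ↓ 0` and regular subgradients `w k` at points `u k → x` with `f (u k) → f x`. -/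
def horizonSubdiff (f : H → EReal) (x : H) : Set H :=
  {v | f x ≠ ⊥ ∧ f x ≠ ⊤ ∧ ∃ (u : ℕ → H) (w : ℕ → H) (l : ℕ → ℝ), Tendsto u atTop (𝓝 x) ∧
    Tendsto (fun k => f (u k)) atTop (𝓝 (f x)) ∧ (∀ k, w k ∈ regularSubdiff f (u k)) ∧
    (∀ k, 0 < l k) ∧ Tendsto l atTop (𝓝 0) ∧ Tendsto (fun k => l k • w k) atTop (𝓝 v)}

/-- The subderivative `df(x)(w)`: the lower limit of `(f (x + τ w') - f x) / τ` as `τ ↓ 0` and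
`w' → w`. -/
def subderiv (f : H → EReal) (x w : H) : EReal :=
  liminf (fun p : ℝ × H => (f (x + p.1 • p.2) - f x) / (p.1 : EReal)) (𝓝[>] (0 : ℝ) ×ˢ 𝓝 w)

/-- The indicator function of `S`: `0` on `S` and `+∞` off `S`. -/
def indicatorFun (S : Set H) : H → EReal := by
  classical
  exact fun x => if x ∈ S then 0 else ⊤

/-- The point `(x, f x)` of the graph (for `f x` finite). -/
def graphPoint (f : H → EReal) (x : H) : WithLp 2 (H × ℝ) := WithLp.toLp 2 (x, (f x).toReal)

/-- The vertical cylinder `S × ℝ`. -/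
def cylinder (S : Set H) : Set (WithLp 2 (H × ℝ)) := {p | p.fst ∈ S}

/-- `𝒯_f(x)`: all `v` such that `(v, h)` is tangent to the epigraph at `(x, f x)` for some `h`. -/
def domTangent (f : H → EReal) (x : H) : Set H :=
  {v | ∃ h : ℝ, (WithLp.toLp 2 (v, h) : WithLp 2 (H × ℝ)) ∈ tangentCone (epi f) (graphPoint f x)}

end General

section Conditions

variable {X Y : Type*} [NormedAddCommGroup X] [InnerProductSpace ℝ X] [FiniteDimensional ℝ X]
  [NormedAddCommGroup Y] [InnerProductSpace ℝ Y] [FiniteDimensional ℝ Y]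

/-- The affine set `ℰ = {x | A x = b}`. -/
def affSet (A : X →ₗ[ℝ] Y) (b : Y) : Set X := {x | A x = b}

/-- The function `f_ℰ = f + δ_ℰ`. -/
def restr (f : X → EReal) (A : X →ₗ[ℝ] Y) (b : Y) : X → EReal :=
  fun x => f x + indicatorFun (affSet A b) x

/-- The feasible set `ℱ = ℰ ∩ dom f`. -/
def feasible (f : X → EReal) (A : X →ₗ[ℝ] Y) (b : Y) : Set X := affSet A b ∩ effDom f

/-- The subspace `A* Y`. -/
def adjRange (A : X →ₗ[ℝ] Y) : Submodule ℝ X := LinearMap.range (LinearMap.adjoint A)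

/-- Subdifferential sum rule. -/
def SSR (f : X → EReal) (A : X →ₗ[ℝ] Y) (b : Y) (x : X) : Prop :=
  subdiff (restr f A b) x = subdiff f x + (adjRange A : Set X)

/-- Restricted subdifferential sum rule. -/
def RSSR (f : X → EReal) (A : X →ₗ[ℝ] Y) (b : Y) (x : X) : Prop :=
  subdiff (restr f A b) x = subdiff f x + (adjRange A : Set X) ∧
  horizonSubdiff (restr f A b) x = horizonSubdiff f x + (adjRange A : Set X)

/-- Epigraphical strong conical hull intersection property. -/
def EpiCHIP (f : X → EReal) (A : X →ₗ[ℝ] Y) (b : Y) (x : X) : Prop :=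
  normalCone (epi (restr f A b)) (graphPoint f x) =
    normalCone (epi f) (graphPoint f x) + normalCone (cylinder (affSet A b)) (graphPoint f x)

/-- Epigraphical transversality, in terms of normal cones. -/
def EpiTransversality (f : X → EReal) (A : X →ₗ[ℝ] Y) (b : Y) (x : X) : Prop :=
  normalCone (epi f) (graphPoint f x) ∩ normalCone (cylinder (affSet A b)) (graphPoint f x) = {0}

/-- Epigraphical transversality, in terms of tangent cones. -/
def EpiTransversalityTangent (f : X → EReal) (A : X →ₗ[ℝ] Y) (b : Y) (x : X) : Prop :=
  tangentCone (epi f) (graphPoint f x) + tangentCone (cylinder (affSet A b)) (graphPoint f x) =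
    Set.univ

/-- Horizon qualification condition. -/
def HorizonQC (f : X → EReal) (A : X →ₗ[ℝ] Y) (x : X) : Prop :=
  horizonSubdiff f x ∩ (adjRange A : Set X) = {0}

/-- Robinson constraint qualification `𝒯_f(x) + ker A = X`. -/
def RCQ (f : X → EReal) (A : X →ₗ[ℝ] Y) (x : X) : Prop :=
  domTangent f x + (LinearMap.ker A : Set X) = Set.univ

/-- Robinson constraint qualification in the image form `A 𝒯_f(x) = Y`. -/
def RCQImage (f : X → EReal) (A : X →ₗ[ℝ] Y) (x : X) : Prop :=
  A '' domTangent f x = Set.univ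

/-- Robinson constraint nondegeneracy `lin 𝒯_f(x) + ker A = X`. -/
def Nondegeneracy (f : X → EReal) (A : X →ₗ[ℝ] Y) (x : X) : Prop :=
  (lin (domTangent f x) : Set X) + (LinearMap.ker A : Set X) = Set.univ

/-- Robinson constraint nondegeneracy in the image form `A (lin 𝒯_f(x)) = Y`. -/
def NondegeneracyImage (f : X → EReal) (A : X →ₗ[ℝ] Y) (x : X) : Prop :=
  A '' (lin (domTangent f x) : Set X) = Set.univ

end Conditions

end RegHierarchy

end

/-!
Everything is read off the epigraph. For a closed proper convex function the limiting normals to the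
epigraph at `(x, f x)` are the normals of convex analysis; those of the form `(v, -1)` are the
subgradients (`mem_subdiff_iff`) and the horizontal ones `(v, 0)` are the horizon subgradients
(`mem_horizonSubdiff_iff`). Only one inclusion needs an argument: a horizontal normal has to be
approximated by scaled subgradients even where `f` has no subgradient, and a proximal minimization
provides them (`exists_regularSubdiff_of_horizontal_normal`). Since no normal points upwards, the
normal cone is determined by these two slices, and normals to the cylinder over `{x | A x = b}` are
the `(A* y, 0)`. Comparing slices turns the restricted sum rule into the epigraphical CHIP
(`rssr_iff_epiCHIP`), and epigraphical transversality into the horizon qualification condition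
(`epiTransversality_iff_horizonQC`).

The tangential conditions are dual to the normal ones: the normal cone is the polar of the tangent
cone, and a convex cone in a finite-dimensional space, closed or not, is the whole space as soon as
its polar is zero (`eq_univ_iff_polar_eq_zero`). Applied to sums of cones this gives the tangential
form of transversality and the Robinson constraint qualification, since the polar of `𝒯_f(x)` is the
set of horizontal normals.

That transversality implies the CHIP is the sum rule for normals to the intersection of a closed
convex set with an affine subspace (`exists_orthogonal_sub_mem_normalCone`). It is proved by
penalizing the distance to the affine subspace: the minimizers of the penalized problems tend to
the base point, their first-order conditions split the given normal approximately, and the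
qualification condition keeps the parts bounded.
-/

namespace RegHierarchy

/-! ### Tangent and normal cones of convex sets -/

section Cones

variable {H : Type*} [NormedAddCommGroup H] [InnerProductSpace ℝ H] {S C : Set H} {p d : H}

/-- The tangent cone without the distance function: for small `t`, some point of `S` is within `ε t`
of `p + t d`. -/
theorem mem_tangentCone_iff :
    d ∈ tangentCone S p ↔ p ∈ S ∧
      ∀ ε : ℝ, 0 < ε → ∀ᶠ t in 𝓝[>] (0 : ℝ), ∃ z ∈ S, dist (p + t • d) z < ε * t := by
  refine and_congr_right fun hp => ?_
  rw [isLittleO_iff]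
  constructor
  · intro h ε hε
    filter_upwards [h (half_pos hε), self_mem_nhdsWithin] with t ht ht0
    have ht0 : 0 < t := ht0
    rw [Real.norm_of_nonneg Metric.infDist_nonneg, Real.norm_of_nonneg ht0.le] at ht
    exact (Metric.infDist_lt_iff ⟨p, hp⟩).1 (ht.trans_lt (by nlinarith))
  · intro h ε hε
    filter_upwards [h ε hε, self_mem_nhdsWithin] with t ht ht0
    have ht0 : 0 < t := ht0
    obtain ⟨z, hz, hlt⟩ := ht
    rw [Real.norm_of_nonneg Metric.infDist_nonneg, Real.norm_of_nonneg ht0.le]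
    exact (Metric.infDist_le_dist_of_mem hz).trans hlt.le

theorem sub_mem_tangentCone (hC : Convex ℝ C) (hp : p ∈ C) {z : H} (hz : z ∈ C) :
    z - p ∈ tangentCone C p := by
  refine mem_tangentCone_iff.2 ⟨hp, fun ε hε => ?_⟩
  filter_upwards [Ioo_mem_nhdsGT (zero_lt_one' ℝ)] with t ht
  refine ⟨p + t • (z - p), hC.add_smul_sub_mem hp hz ⟨ht.1.le, ht.2.le⟩, ?_⟩
  rw [dist_self]
  exact mul_pos hε ht.1

theorem smul_mem_tangentCone {c : ℝ} (hc : 0 < c) (hd : d ∈ tangentCone S p) :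
    c • d ∈ tangentCone S p := by
  rw [mem_tangentCone_iff] at hd ⊢
  refine ⟨hd.1, fun ε hε => ?_⟩
  have hlim : Tendsto (fun t : ℝ => t * c) (𝓝[>] 0) (𝓝[>] 0) := by
    refine tendsto_nhdsWithin_iff.2 ⟨?_, ?_⟩
    · have : Tendsto (fun t : ℝ => t * c) (𝓝 0) (𝓝 (0 * c)) :=
        Continuous.tendsto (by fun_prop) _
      rw [zero_mul] at this
      exact this.mono_left nhdsWithin_le_nhds
    · filter_upwards [self_mem_nhdsWithin] with t ht
      exact mul_pos ht hc
  filter_upwards [hlim.eventually (hd.2 (ε / c) (div_pos hε hc))] with t ht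
  obtain ⟨z, hz, h⟩ := ht
  refine ⟨z, hz, ?_⟩
  rw [smul_smul]
  refine h.trans_eq ?_
  field_simp

theorem add_mem_tangentCone (hC : Convex ℝ C) {d e : H} (hd : d ∈ tangentCone C p)
    (he : e ∈ tangentCone C p) : d + e ∈ tangentCone C p := by
  have hd' := smul_mem_tangentCone two_pos hd
  have he' := smul_mem_tangentCone two_pos he
  rw [mem_tangentCone_iff] at hd' he' ⊢
  refine ⟨hd'.1, fun ε hε => ?_⟩
  filter_upwards [hd'.2 ε hε, he'.2 ε hε] with t h₁ h₂
  obtain ⟨y, hy, hy'⟩ := h₁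
  obtain ⟨z, hz, hz'⟩ := h₂
  -- `p + t (d + e)` is the midpoint of `p + 2 t d` and `p + 2 t e`.
  refine ⟨(2⁻¹ : ℝ) • y + (2⁻¹ : ℝ) • z,
    hC hy hz (by norm_num) (by norm_num) (by norm_num), ?_⟩
  have key : p + t • (d + e) - ((2⁻¹ : ℝ) • y + (2⁻¹ : ℝ) • z) =
      (2⁻¹ : ℝ) • (p + t • (2 : ℝ) • d - y) + (2⁻¹ : ℝ) • (p + t • (2 : ℝ) • e - z) := by
    module
  rw [dist_eq_norm] at hy' hz' ⊢
  rw [key]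
  refine (norm_add_le _ _).trans_lt ?_
  rw [norm_smul, norm_smul, Real.norm_of_nonneg (by norm_num)]
  linarith

theorem isClosed_tangentCone : IsClosed (tangentCone S p) := by
  refine isClosed_of_closure_subset fun d hd => ?_
  rw [Metric.mem_closure_iff] at hd
  obtain ⟨e₀, he₀, -⟩ := hd 1 one_pos
  refine mem_tangentCone_iff.2 ⟨he₀.1, fun ε hε => ?_⟩
  obtain ⟨e, he, hde⟩ := hd (ε / 2) (half_pos hε)
  filter_upwards [(mem_tangentCone_iff.1 he).2 (ε / 2) (half_pos hε), self_mem_nhdsWithin]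
    with t ht ht0
  have ht0 : 0 < t := ht0
  obtain ⟨z, hz, h⟩ := ht
  refine ⟨z, hz, (dist_triangle _ (p + t • e) _).trans_lt ?_⟩
  have : dist (p + t • d) (p + t • e) = t * dist d e := by
    rw [dist_add_left, dist_smul₀, Real.norm_of_nonneg ht0.le]
  rw [this]
  nlinarith

theorem mem_regularNormalCone_iff (hC : Convex ℝ C) (hp : p ∈ C) :
    d ∈ regularNormalCone C p ↔ ∀ z ∈ C, inner ℝ d (z - p) ≤ 0 := by
  constructor
  · rintro ⟨-, h⟩ z hz
    refine le_of_forall_pos_le_add fun ε hε => ?_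
    have hlim : Tendsto (fun t : ℝ => p + t • (z - p)) (𝓝[>] 0) (𝓝[C] p) := by
      refine tendsto_nhdsWithin_iff.2 ⟨?_, ?_⟩
      · have : Tendsto (fun t : ℝ => p + t • (z - p)) (𝓝 0) (𝓝 (p + (0 : ℝ) • (z - p))) :=
          Continuous.tendsto (by fun_prop) _
        rw [zero_smul, add_zero] at this
        exact this.mono_left nhdsWithin_le_nhds
      · filter_upwards [Ioo_mem_nhdsGT (zero_lt_one' ℝ)] with t ht
        exact hC.add_smul_sub_mem hp hz ⟨ht.1.le, ht.2.le⟩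
    have hpos : 0 < ‖z - p‖ + 1 := by positivity
    obtain ⟨t, ht, ht0⟩ :=
      ((hlim.eventually (h (ε / (‖z - p‖ + 1)) (div_pos hε hpos))).and self_mem_nhdsWithin).exists
    have ht0 : 0 < t := ht0
    rw [add_sub_cancel_left, inner_smul_right, norm_smul, Real.norm_of_nonneg ht0.le] at ht
    have h1 : inner ℝ d (z - p) ≤ ε / (‖z - p‖ + 1) * ‖z - p‖ := by
      refine le_of_mul_le_mul_left ?_ ht0
      linarith
    have h2 : ε / (‖z - p‖ + 1) * ‖z - p‖ ≤ ε := by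
      rw [div_mul_eq_mul_div, div_le_iff₀ hpos]
      nlinarith
    linarith
  · intro h
    refine ⟨hp, fun ε hε => ?_⟩
    filter_upwards [self_mem_nhdsWithin] with z hz
    exact (h z hz).trans (by positivity)

theorem mem_normalCone_iff (hC : Convex ℝ C) (hp : p ∈ C) :
    d ∈ normalCone C p ↔ ∀ z ∈ C, inner ℝ d (z - p) ≤ 0 := by
  constructor
  · rintro ⟨-, u, w, hu, hw, huw⟩ z hz
    have hlim : Tendsto (fun k => inner ℝ (w k) (z - u k)) atTop (𝓝 (inner ℝ d (z - p))) :=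
      hw.inner (tendsto_const_nhds.sub hu)
    exact le_of_tendsto' hlim fun k => (mem_regularNormalCone_iff hC (huw k).1).1 (huw k) z hz
  · intro h
    exact ⟨hp, fun _ => p, fun _ => d, tendsto_const_nhds, tendsto_const_nhds,
      fun _ => (mem_regularNormalCone_iff hC hp).2 h⟩

/-- For a convex set the normal cone is the polar of the tangent cone. -/
theorem mem_normalCone_iff_tangentCone (hC : Convex ℝ C) (hp : p ∈ C) :
    d ∈ normalCone C p ↔ ∀ v ∈ tangentCone C p, inner ℝ d v ≤ 0 := by
  rw [mem_normalCone_iff hC hp]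
  refine ⟨fun h v hv => ?_, fun h z hz => h _ (sub_mem_tangentCone hC hp hz)⟩
  refine le_of_forall_pos_le_add fun ε hε => ?_
  have hpos : 0 < ‖d‖ + 1 := by positivity
  obtain ⟨t, ⟨z, hz, hzt⟩, ht0⟩ := (((mem_tangentCone_iff.1 hv).2 (ε / (‖d‖ + 1))
    (div_pos hε hpos)).and self_mem_nhdsWithin).exists
  have ht0 : 0 < t := ht0
  have h1 : t * inner ℝ d v = inner ℝ d (z - p) + inner ℝ d (p + t • v - z) := by
    rw [← inner_add_right, ← inner_smul_right]
    congr 1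
    abel
  have h2 : inner ℝ d (p + t • v - z) ≤ ‖d‖ * (ε / (‖d‖ + 1) * t) := by
    refine (real_inner_le_norm _ _).trans ?_
    rw [dist_eq_norm] at hzt
    gcongr
  have h3 : ‖d‖ * (ε / (‖d‖ + 1) * t) ≤ ε * t := by
    rw [← mul_assoc]
    gcongr
    rw [mul_div_assoc', div_le_iff₀ hpos]
    nlinarith
  refine le_of_mul_le_mul_left ?_ ht0
  linarith [h z hz]

/-- A convex cone in a finite-dimensional space, closed or not, is the whole space as soon as its
polar is trivial. -/
theorem eq_univ_iff_polar_eq_zero [FiniteDimensional ℝ H] {K : Set H} (h0 : (0 : H) ∈ K)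
    (hadd : ∀ a ∈ K, ∀ b ∈ K, a + b ∈ K) (hsmul : ∀ c : ℝ, 0 < c → ∀ a ∈ K, c • a ∈ K) :
    K = Set.univ ↔ ∀ d : H, (∀ k ∈ K, inner ℝ d k ≤ 0) → d = 0 := by
  constructor
  · rintro rfl d hd
    exact real_inner_self_nonpos.1 (hd d trivial)
  · intro h
    have hconv : Convex ℝ K := by
      refine convex_iff_forall_pos.2 fun a ha b hb s t hs ht _ => ?_
      exact hadd _ (hsmul s hs a ha) _ (hsmul t ht b hb)
    have hspan : affineSpan ℝ K = ⊤ := by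
      rw [AffineSubspace.affineSpan_eq_top_iff_vectorSpan_eq_top_of_nonempty ℝ H H ⟨0, h0⟩,
        ← Submodule.orthogonal_eq_bot_iff, Submodule.eq_bot_iff]
      intro d hd
      refine h d fun k hk => le_of_eq ?_
      have : k ∈ vectorSpan ℝ K := by
        simpa using vsub_mem_vectorSpan ℝ hk h0
      exact Submodule.inner_left_of_mem_orthogonal this hd
    by_contra hne
    obtain ⟨y, hy⟩ := (Set.ne_univ_iff_exists_notMem K).1 hne
    obtain ⟨g, hg0, hg⟩ := geometric_hahn_banach_of_nonempty_interior_point hconv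
      (fun hy' => hy (interior_subset hy')) (hconv.interior_nonempty_iff_affineSpan_eq_top.2 hspan)
    refine hg0 ?_
    have hle : ∀ k ∈ K, g k ≤ 0 := by
      intro k hk
      by_contra! hpos
      have hc : 0 < (|g y| + 1) / g k := by positivity
      have := hg _ (hsmul _ hc k hk)
      rw [map_smul, smul_eq_mul, div_mul_cancel₀ _ hpos.ne'] at this
      linarith [le_abs_self (g y)]
    have := h ((InnerProductSpace.toDual ℝ H).symm g) fun k hk => by
      simpa using hle k hk
    simpa using this

theorem zero_mem_normalCone (hC : Convex ℝ C) (hp : p ∈ C) : (0 : H) ∈ normalCone C p :=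
  (mem_normalCone_iff hC hp).2 fun z _ => by simp

theorem inter_eq_singleton_zero_iff {H : Type*} [Zero H] {S T : Set H} (hS : 0 ∈ S) (hT : 0 ∈ T) :
    S ∩ T = {0} ↔ ∀ d ∈ S, d ∈ T → d = 0 := by
  rw [Set.eq_singleton_iff_unique_mem]
  exact ⟨fun h d hd hd' => h.2 d ⟨hd, hd'⟩, fun h => ⟨⟨hS, hT⟩, fun d hd => h d hd.1 hd.2⟩⟩

/-- The polar of a sum of cones is the intersection of the polars. -/
theorem forall_mem_add_inner_nonpos_iff {S T : Set H} (hS : 0 ∈ S) (hT : 0 ∈ T) :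
    (∀ k ∈ S + T, inner ℝ d k ≤ 0) ↔
      (∀ s ∈ S, inner ℝ d s ≤ 0) ∧ ∀ t ∈ T, inner ℝ d t ≤ 0 := by
  constructor
  · intro h
    refine ⟨fun s hs => ?_, fun t ht => ?_⟩
    · simpa using h (s + 0) (Set.add_mem_add hs hT)
    · simpa using h (0 + t) (Set.add_mem_add hS ht)
  · rintro ⟨h1, h2⟩ _ ⟨s, hs, t, ht, rfl⟩
    rw [inner_add_right]
    exact add_nonpos (h1 s hs) (h2 t ht)

end Cones

/-! ### Normals to an intersection with an affine subspace -/

section NormalSum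

variable {H : Type*} [NormedAddCommGroup H] [InnerProductSpace ℝ H] {C : Set H} {p d : H}

theorem mem_normalCone_of_tendsto (hC : Convex ℝ C) (hp : p ∈ C) {u w : ℕ → H}
    (hu : Tendsto u atTop (𝓝 p)) (hw : Tendsto w atTop (𝓝 d))
    (h : ∀ᶠ k in atTop, w k ∈ regularNormalCone C (u k)) : d ∈ normalCone C p := by
  refine (mem_normalCone_iff hC hp).2 fun z hz => ?_
  have hlim : Tendsto (fun k => inner ℝ (w k) (z - u k)) atTop (𝓝 (inner ℝ d (z - p))) :=
    hw.inner (tendsto_const_nhds.sub hu)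
  refine le_of_tendsto hlim ?_
  filter_upwards [h] with k hk
  exact (mem_regularNormalCone_iff hC hk.1).1 hk z hz

theorem smul_mem_regularNormalCone (hC : Convex ℝ C) {c : ℝ} (hc : 0 ≤ c)
    (hd : d ∈ regularNormalCone C p) : c • d ∈ regularNormalCone C p := by
  refine (mem_regularNormalCone_iff hC hd.1).2 fun z hz => ?_
  rw [real_inner_smul_left]
  exact mul_nonpos_of_nonneg_of_nonpos hc ((mem_regularNormalCone_iff hC hd.1).1 hd z hz)

theorem smul_mem_normalCone (hC : Convex ℝ C) {c : ℝ} (hc : 0 ≤ c)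
    (hd : d ∈ normalCone C p) : c • d ∈ normalCone C p := by
  refine (mem_normalCone_iff hC hd.1).2 fun z hz => ?_
  rw [real_inner_smul_left]
  exact mul_nonpos_of_nonneg_of_nonpos hc ((mem_normalCone_iff hC hd.1).1 hd z hz)

theorem mem_regularNormalCone_of_sq_bound (hp : p ∈ C) {M : ℝ} (hM : 0 < M)
    (h : ∀ᶠ z in 𝓝[C] p, inner ℝ d (z - p) ≤ M * ‖z - p‖ ^ 2) : d ∈ regularNormalCone C p := by
  refine ⟨hp, fun ε hε => ?_⟩
  filter_upwards [h, nhdsWithin_le_nhds (Metric.ball_mem_nhds p (div_pos hε hM))] with z hz hzb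
  rw [mem_ball_iff_norm, lt_div_iff₀ hM] at hzb
  nlinarith [norm_nonneg (z - p)]

/-- A minimizer over `C`, near `p`, of
`z ↦ ‖z - p‖ ^ 2 / 2 + k / 2 * dist (z, p + L) ^ 2 - ⟪n, z - p⟫`. The first inequality compares it with the value `0` at `p`; the second claim is the first-order
condition. -/
theorem exists_penalized_normal [FiniteDimensional ℝ H] (hcl : IsClosed C) (hp : p ∈ C)
    (L : Submodule ℝ H) (n : H) (k : ℕ) :
    ∃ q ∈ C ∩ Metric.closedBall p 1,
      ‖q - p‖ ^ 2 / 2 + k / 2 * ‖Lᗮ.starProjection (q - p)‖ ^ 2 ≤ inner ℝ n (q - p) ∧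
      (q ∈ Metric.ball p 1 →
        n - (q - p) - (k : ℝ) • Lᗮ.starProjection (q - p) ∈ regularNormalCone C q) := by
  set P := Lᗮ.starProjection with hP
  set g : H → ℝ := fun z => ‖z - p‖ ^ 2 / 2 + k / 2 * ‖P (z - p)‖ ^ 2 - inner ℝ n (z - p) with hg
  have hgc : Continuous g := by fun_prop
  have hcomp : IsCompact (C ∩ Metric.closedBall p 1) :=
    (isCompact_closedBall p 1).inter_left hcl
  have hpB : p ∈ C ∩ Metric.closedBall p 1 := ⟨hp, Metric.mem_closedBall_self zero_le_one⟩
  obtain ⟨q, hqB, hq⟩ := hcomp.exists_isMinOn ⟨p, hpB⟩ hgc.continuousOn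
  refine ⟨q, hqB, ?_, fun hqb => ?_⟩
  · have : g q ≤ g p := hq hpB
    simp only [hg, sub_self, map_zero, norm_zero, inner_zero_right] at this
    linarith
  · have hM : (0 : ℝ) < (1 + k) / 2 := by positivity
    refine mem_regularNormalCone_of_sq_bound hqB.1 hM ?_
    filter_upwards [self_mem_nhdsWithin,
      nhdsWithin_le_nhds (Metric.isOpen_ball.mem_nhds hqb)] with z hzC hzb
    have hle : g q ≤ g z := hq ⟨hzC, Metric.ball_subset_closedBall hzb⟩
    have hsplit : z - p = (q - p) + (z - q) := by abel
    have hsym : inner ℝ (P (q - p)) (P (z - q)) = inner ℝ (P (q - p)) (z - q) := by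
      rw [hP, ← Submodule.inner_starProjection_left_eq_right,
        Submodule.starProjection_eq_self_iff.2 (Submodule.starProjection_apply_mem _ _)]
    have hPle : ‖P (z - q)‖ ≤ ‖z - q‖ := Submodule.norm_starProjection_apply_le _ _
    have hPsq : ‖P (z - q)‖ ^ 2 ≤ ‖z - q‖ ^ 2 := by gcongr
    simp only [hg] at hle
    rw [hsplit, map_add, norm_add_sq_real, norm_add_sq_real, inner_add_right, hsym] at hle
    rw [inner_sub_left, inner_sub_left, real_inner_smul_left]
    have hk : (0 : ℝ) ≤ k := k.cast_nonneg
    nlinarith [mul_le_mul_of_nonneg_left hPsq hk]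

/-- The sum rule for normals to the intersection of a closed convex set with an affine subspace
`p + L`, under the basic qualification condition: no nonzero normal to `C` at `p` is orthogonal to
`L`. -/
theorem exists_orthogonal_sub_mem_normalCone [FiniteDimensional ℝ H] (hC : Convex ℝ C)
    (hcl : IsClosed C) (hp : p ∈ C) (L : Submodule ℝ H)
    (hqual : ∀ d ∈ normalCone C p, d ∈ Lᗮ → d = 0) {n : H}
    (hn : ∀ z ∈ C, z - p ∈ L → inner ℝ n (z - p) ≤ 0) :
    ∃ η ∈ Lᗮ, n - η ∈ normalCone C p := by
  choose q hqB hqle hqn using exists_penalized_normal hcl hp L n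
  set P := Lᗮ.starProjection with hP
  obtain ⟨a, ha, φ, hφ, hlim⟩ :=
    ((isCompact_closedBall p 1).inter_left hcl).tendsto_subseq hqB
  have hφ' : Tendsto (fun k => ((φ k : ℕ) : ℝ)) atTop atTop :=
    tendsto_natCast_atTop_atTop.comp hφ.tendsto_atTop
  have hbound : ∀ k, inner ℝ n (q k - p) ≤ ‖n‖ := fun k => by
    have h1 : ‖q k - p‖ ≤ 1 := mem_closedBall_iff_norm.1 (hqB k).2
    exact (real_inner_le_norm _ _).trans (mul_le_of_le_one_right (norm_nonneg _) h1)
  have hsub : Tendsto (fun k => q (φ k) - p) atTop (𝓝 (a - p)) := hlim.sub_const p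
  -- The penalty forces the limit of the minimizers into `p + L`.
  have hPa : P (a - p) = 0 := by
    have h1 : Tendsto (fun k => ‖P (q (φ k) - p)‖ ^ 2) atTop (𝓝 (‖P (a - p)‖ ^ 2)) :=
      (((P.continuous.tendsto _).comp hsub).norm).pow 2
    have h2 : Tendsto (fun k => 2 * ‖n‖ / (φ k : ℝ)) atTop (𝓝 0) :=
      hφ'.const_div_atTop _
    have h3 : ‖P (a - p)‖ ^ 2 ≤ 0 := by
      refine le_of_tendsto_of_tendsto h1 h2 ?_
      filter_upwards [hφ'.eventually_gt_atTop 0] with k hk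
      rw [le_div_iff₀ hk]
      nlinarith [hqle (φ k), hbound (φ k), sq_nonneg ‖q (φ k) - p‖]
    exact norm_eq_zero.1 (pow_eq_zero_iff two_ne_zero |>.1 (le_antisymm h3 (sq_nonneg _)))
  have haL : a - p ∈ L := by
    have := (Submodule.starProjection_apply_eq_zero_iff _).1 hPa
    rwa [Submodule.orthogonal_orthogonal] at this
  have hap : a = p := by
    have h1 : Tendsto (fun k => ‖q (φ k) - p‖ ^ 2 / 2) atTop (𝓝 (‖a - p‖ ^ 2 / 2)) :=
      (hsub.norm.pow 2).div_const 2
    have h2 : Tendsto (fun k => inner ℝ n (q (φ k) - p)) atTop (𝓝 (inner ℝ n (a - p))) :=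
      tendsto_const_nhds.inner hsub
    have h3 : ‖a - p‖ ^ 2 / 2 ≤ inner ℝ n (a - p) :=
      le_of_tendsto_of_tendsto' h1 h2 fun k => by
        have : 0 ≤ ((φ k : ℕ) : ℝ) / 2 * ‖P (q (φ k) - p)‖ ^ 2 := by positivity
        linarith [hqle (φ k)]
    have h4 := hn a ha.1 haL
    have h5 : ‖a - p‖ ^ 2 = 0 := le_antisymm (by linarith) (sq_nonneg _)
    exact sub_eq_zero.1 (norm_eq_zero.1 (pow_eq_zero_iff two_ne_zero |>.1 h5))
  subst hap
  rw [sub_self] at hsub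
  set e : ℕ → H := fun k => ((φ k : ℕ) : ℝ) • P (q (φ k) - a) with he
  set t : ℕ → ℝ := fun k => (1 + ‖e k‖)⁻¹ with ht
  have htpos : ∀ k, 0 < t k := fun k => by positivity
  have htmul : ∀ k, t k + ‖t k • e k‖ = 1 := fun k => by
    rw [norm_smul, Real.norm_of_nonneg (htpos k).le, ht]
    field_simp
  -- Scaling by `t` makes the penalty terms bounded; if `t → 0` the limit is a normal to `C`
  -- orthogonal to `L` and of norm one, which is excluded.
  have hmem : ∀ k, (t k, t k • e k) ∈ Set.Icc (0 : ℝ) 1 ×ˢ Metric.closedBall (0 : H) 1 := by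
    intro k
    refine ⟨⟨(htpos k).le, ?_⟩, mem_closedBall_zero_iff.2 ?_⟩
    · linarith [htmul k, norm_nonneg (t k • e k)]
    · linarith [htmul k, htpos k]
  obtain ⟨⟨s, η⟩, -, ψ, hψ, hlim'⟩ :=
    (isCompact_Icc.prod (isCompact_closedBall (0 : H) 1)).tendsto_subseq hmem
  have hs : Tendsto (fun k => t (ψ k)) atTop (𝓝 s) :=
    (continuous_fst.tendsto _).comp hlim'
  have hη : Tendsto (fun k => t (ψ k) • e (ψ k)) atTop (𝓝 η) :=
    (continuous_snd.tendsto _).comp hlim'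
  have hs0 : 0 ≤ s := ge_of_tendsto' hs fun k => (htpos _).le
  have hsη : s + ‖η‖ = 1 :=
    tendsto_nhds_unique (hs.add hη.norm) (by simp only [htmul]; exact tendsto_const_nhds)
  have hηL : η ∈ Lᗮ := (Submodule.isClosed_orthogonal L).mem_of_tendsto hη <|
    Eventually.of_forall fun k => Submodule.smul_mem _ _ <| Submodule.smul_mem _ _ <|
      Submodule.starProjection_apply_mem _ _
  have hlimN : s • n - η ∈ normalCone C a := by
    have hq' : Tendsto (fun k => q (φ (ψ k))) atTop (𝓝 a) := hlim.comp hψ.tendsto_atTop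
    have hw : Tendsto (fun k => t (ψ k) • (n - (q (φ (ψ k)) - a) - e (ψ k))) atTop
        (𝓝 (s • (n - 0) - η)) := by
      simp only [smul_sub (t _) (_ - _) (e _)]
      exact (hs.smul (tendsto_const_nhds.sub (hsub.comp hψ.tendsto_atTop))).sub hη
    rw [sub_zero] at hw
    refine mem_normalCone_of_tendsto hC hp hq' hw ?_
    filter_upwards [hq'.eventually (Metric.ball_mem_nhds a one_pos)] with k hk
    exact smul_mem_regularNormalCone hC (htpos _).le (hqn _ hk)
  rcases hs0.eq_or_lt with rfl | hspos
  · have : -η = 0 := hqual (-η) (by simpa using hlimN) (Submodule.neg_mem _ hηL)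
    rw [neg_eq_zero] at this
    simp [this] at hsη
  · refine ⟨s⁻¹ • η, Submodule.smul_mem _ _ hηL, ?_⟩
    have := smul_mem_normalCone hC (inv_nonneg.2 hs0) hlimN
    rwa [smul_sub, inv_smul_smul₀ hspos.ne'] at this

end NormalSum

/-! ### Normals to epigraphs and subgradients -/

section Epigraph

variable {H : Type*} [NormedAddCommGroup H] [InnerProductSpace ℝ H] {g : H → EReal} {x v : H}

omit [NormedAddCommGroup H] [InnerProductSpace ℝ H] in
theorem graphPoint_mem_epi (ht : g x ≠ ⊤) : graphPoint g x ∈ epi g :=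
  EReal.le_coe_toReal ht

omit [InnerProductSpace ℝ H] in
theorem isClosed_epi (hg : LowerSemicontinuous g) : IsClosed (epi g) := by
  have hcont : Continuous fun p : WithLp 2 (H × ℝ) => (p.fst, (p.snd : EReal)) :=
    (WithLp.prod_continuous_ofLp 2 H ℝ).fst.prodMk
      (continuous_coe_real_ereal.comp (WithLp.prod_continuous_ofLp 2 H ℝ).snd)
  exact hg.isClosed_epigraph.preimage hcont

theorem inner_toLp_sub_graphPoint (s τ : ℝ) (z : H) :
    inner ℝ (WithLp.toLp 2 (v, s)) (WithLp.toLp 2 (z, τ) - graphPoint g x) =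
      inner ℝ v (z - x) + s * (τ - (g x).toReal) := by
  simp [WithLp.prod_inner_apply, graphPoint, mul_comm]

theorem mem_normalCone_epi_iff (hg : IsConvexFun g) (ht : g x ≠ ⊤) {s : ℝ} :
    WithLp.toLp 2 (v, s) ∈ normalCone (epi g) (graphPoint g x) ↔
      ∀ (z : H) (τ : ℝ), g z ≤ τ → inner ℝ v (z - x) + s * (τ - (g x).toReal) ≤ 0 := by
  rw [mem_normalCone_iff hg (graphPoint_mem_epi ht)]
  constructor
  · intro h z τ hz
    rw [← inner_toLp_sub_graphPoint]
    exact h (WithLp.toLp 2 (z, τ)) hz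
  · intro h z hz
    have := h z.fst z.snd hz
    rwa [← inner_toLp_sub_graphPoint] at this

/-- The epigraph contains every point above the graph, so its normals never point upwards. -/
theorem nonpos_of_mem_normalCone_epi (hg : IsConvexFun g) (ht : g x ≠ ⊤) {s : ℝ}
    (h : WithLp.toLp 2 (v, s) ∈ normalCone (epi g) (graphPoint g x)) : s ≤ 0 := by
  have := (mem_normalCone_epi_iff hg ht).1 h x ((g x).toReal + 1)
    ((EReal.le_coe_toReal ht).trans (EReal.coe_le_coe_iff.2 (by linarith)))
  simpa using this

/-- This direction holds without convexity. -/
theorem mem_regularNormalCone_epi_of_mem_regularSubdiff (h : v ∈ regularSubdiff g x) :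
    WithLp.toLp 2 (v, (-1 : ℝ)) ∈ regularNormalCone (epi g) (graphPoint g x) := by
  obtain ⟨hb, ht, h⟩ := h
  refine ⟨graphPoint_mem_epi ht, fun ε hε => ?_⟩
  have hlim : Tendsto (fun p : WithLp 2 (H × ℝ) => p.fst) (𝓝[epi g] (graphPoint g x)) (𝓝 x) :=
    ((WithLp.prod_continuous_ofLp 2 H ℝ).fst.tendsto (graphPoint g x)).mono_left
      nhdsWithin_le_nhds
  filter_upwards [hlim.eventually (h ε hε), self_mem_nhdsWithin] with p hp hpe
  have h1 : g x + ((inner ℝ v (p.fst - x) - ε * ‖p.fst - x‖ : ℝ) : EReal) ≤ (p.snd : ℝ) :=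
    hp.trans hpe
  rw [← EReal.coe_toReal ht hb, ← EReal.coe_add, EReal.coe_le_coe_iff] at h1
  have h2 : ‖p.fst - x‖ ≤ ‖p - graphPoint g x‖ := WithLp.norm_fst_le _ (p - graphPoint g x)
  have h3 := inner_toLp_sub_graphPoint (g := g) (x := x) (v := v) (-1) p.snd p.fst
  change inner ℝ _ (p - graphPoint g x) = _ at h3
  rw [h3]
  nlinarith [mul_le_mul_of_nonneg_left h2 hε.le]

theorem mem_regularSubdiff_of_mem_normalCone_epi (hg : IsConvexFun g) (hp : IsProper g)
    (ht : g x ≠ ⊤) (h : WithLp.toLp 2 (v, (-1 : ℝ)) ∈ normalCone (epi g) (graphPoint g x)) :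
    v ∈ regularSubdiff g x := by
  refine ⟨hp.1 x, ht, fun ε hε => Eventually.of_forall fun z => ?_⟩
  by_cases hz : g z = ⊤
  · simp [hz]
  · have h1 := (mem_normalCone_epi_iff hg ht).1 h z (g z).toReal (EReal.le_coe_toReal hz)
    rw [← EReal.coe_toReal ht (hp.1 x), ← EReal.coe_toReal hz (hp.1 z), ← EReal.coe_add,
      EReal.coe_le_coe_iff]
    have : 0 ≤ ε * ‖z - x‖ := by positivity
    linarith

omit [InnerProductSpace ℝ H] in
theorem tendsto_graphPoint {u : ℕ → H} (hb : g x ≠ ⊥) (ht : g x ≠ ⊤)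
    (hu : Tendsto u atTop (𝓝 x)) (hgu : Tendsto (fun k => g (u k)) atTop (𝓝 (g x))) :
    Tendsto (fun k => graphPoint g (u k)) atTop (𝓝 (graphPoint g x)) :=
  ((WithLp.prod_continuous_toLp 2 H ℝ).tendsto _).comp
    (hu.prodMk_nhds ((EReal.tendsto_toReal ht hb).comp hgu))

/-- The subgradients of a convex function are the normals to its epigraph of slope `-1`. -/
theorem mem_subdiff_iff (hg : IsConvexFun g) (hp : IsProper g) (ht : g x ≠ ⊤) :
    v ∈ subdiff g x ↔ WithLp.toLp 2 (v, (-1 : ℝ)) ∈ normalCone (epi g) (graphPoint g x) := by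
  constructor
  · rintro ⟨hb, -, u, w, hu, hgu, hw, hwv⟩
    refine ⟨graphPoint_mem_epi ht, fun k => graphPoint g (u k), fun k => WithLp.toLp 2 (w k, -1),
      tendsto_graphPoint hb ht hu hgu, ?_,
      fun k => mem_regularNormalCone_epi_of_mem_regularSubdiff (hw k)⟩
    exact ((WithLp.prod_continuous_toLp 2 H ℝ).tendsto _).comp
      (hwv.prodMk_nhds tendsto_const_nhds)
  · intro h
    exact ⟨hp.1 x, ht, fun _ => x, fun _ => v, tendsto_const_nhds, tendsto_const_nhds,
      fun _ => mem_regularSubdiff_of_mem_normalCone_epi hg hp ht h, tendsto_const_nhds⟩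

/-- Every horizontal normal is a limit of scaled subgradients at nearby points, also where `g` has
no subgradient at `x` itself: with `c` large, minimizing
`z ↦ g z - c ⟪v, z - x⟫ + c / 2 * ‖z - x‖ ^ 2` near `x` gives such a subgradient
`c • (v - (u - x))` at the minimizer `u`. -/
theorem exists_regularSubdiff_of_horizontal_normal [FiniteDimensional ℝ H] (hp : IsProper g)
    (hlsc : LowerSemicontinuous g) (ht : g x ≠ ⊤)
    (h : ∀ z, g z ≠ ⊤ → inner ℝ v (z - x) ≤ 0) {δ : ℝ} (hδ : 0 < δ) :
    ∃ (u w : H) (l : ℝ), ‖u - x‖ < δ ∧ g u ≤ g x ∧ w ∈ regularSubdiff g u ∧ 0 < l ∧ l < δ ∧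
      ‖l • w - v‖ < δ := by
  have hball : (Metric.closedBall x δ).Nonempty := ⟨x, Metric.mem_closedBall_self hδ.le⟩
  have hcomp : IsCompact (Metric.closedBall x δ) := isCompact_closedBall x δ
  obtain ⟨a, -, ha⟩ := (hlsc.lowerSemicontinuousOn _).exists_isMinOn hball hcomp
  have hax : g a ≤ g x := ha (Metric.mem_closedBall_self hδ.le)
  have hat : g a ≠ ⊤ := ne_top_of_le_ne_top ht hax
  set r := (g x).toReal with hr
  set m := (g a).toReal with hm
  have hmr : m ≤ r := EReal.toReal_le_toReal hax (hp.1 a) ht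
  -- This `c` makes the minimizer interior to the ball, and `c⁻¹ < δ`.
  set c : ℝ := 2 * (r - m) / δ ^ 2 + 1 / δ + 1 with hc
  have hrm : 0 ≤ r - m := sub_nonneg.2 hmr
  have hc0 : 0 < c := by positivity
  have hcδ : 1 < c * δ := by
    have : c * δ = 2 * (r - m) / δ + 1 + δ := by rw [hc]; field_simp
    have : 0 ≤ 2 * (r - m) / δ := by positivity
    linarith
  have hcδ2 : 2 * (r - m) < c * δ ^ 2 := by
    have : c * δ ^ 2 = 2 * (r - m) + δ + δ ^ 2 := by rw [hc]; field_simp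
    nlinarith
  set φ : H → ℝ := fun z => c / 2 * ‖z - x‖ ^ 2 - c * inner ℝ v (z - x) with hφ
  have hφc : Continuous φ := by fun_prop
  have hsum : LowerSemicontinuous fun z => g z + (φ z : EReal) :=
    hlsc.add' (continuous_coe_real_ereal.comp hφc).lowerSemicontinuous fun z =>
      EReal.continuousAt_add (Or.inr (EReal.coe_ne_bot _)) (Or.inr (EReal.coe_ne_top _))
  obtain ⟨u, huB, hu⟩ := (hsum.lowerSemicontinuousOn _).exists_isMinOn hball hcomp
  have hux : g u + (φ u : EReal) ≤ g x := by
    have : g u + (φ u : EReal) ≤ g x + (φ x : EReal) := hu (Metric.mem_closedBall_self hδ.le)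
    simpa [hφ] using this
  have hut : g u ≠ ⊤ := by
    intro htop
    rw [htop, EReal.top_add_coe, top_le_iff] at hux
    exact ht hux
  have hur : (g u).toReal + φ u ≤ r := by
    rw [← EReal.coe_toReal ht (hp.1 x), ← EReal.coe_toReal hut (hp.1 u), ← EReal.coe_add,
      EReal.coe_le_coe_iff] at hux
    exact hux
  have hmu : m ≤ (g u).toReal := EReal.toReal_le_toReal (ha huB) (hp.1 a) hut
  have hvu := h u hut
  have hcv : c * inner ℝ v (u - x) ≤ 0 := mul_nonpos_of_nonneg_of_nonpos hc0.le hvu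
  have hsq : 0 ≤ c / 2 * ‖u - x‖ ^ 2 := by positivity
  simp only [hφ] at hur
  have hnorm : ‖u - x‖ < δ := by
    refine lt_of_pow_lt_pow_left₀ 2 hδ.le (lt_of_mul_lt_mul_left ?_ hc0.le)
    linarith
  refine ⟨u, c • (v - (u - x)), c⁻¹, hnorm, ?_, ?_, inv_pos.2 hc0, ?_, ?_⟩
  · rw [← EReal.coe_toReal ht (hp.1 x), ← EReal.coe_toReal hut (hp.1 u), EReal.coe_le_coe_iff]
    linarith
  · refine ⟨hp.1 u, hut, fun ε hε => ?_⟩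
    filter_upwards [Metric.isOpen_ball.mem_nhds (mem_ball_iff_norm.2 hnorm),
      Metric.ball_mem_nhds u (div_pos hε hc0)] with z hzB hzu
    by_cases hzt : g z = ⊤
    · simp [hzt]
    have hle : g u + (φ u : EReal) ≤ g z + (φ z : EReal) := hu (Metric.ball_subset_closedBall hzB)
    rw [← EReal.coe_toReal hzt (hp.1 z), ← EReal.coe_toReal hut (hp.1 u), ← EReal.coe_add] at *
    rw [← EReal.coe_add, EReal.coe_le_coe_iff] at hle
    rw [EReal.coe_le_coe_iff]
    rw [mem_ball_iff_norm, lt_div_iff₀ hc0] at hzu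
    have hsplit : z - x = (u - x) + (z - u) := by abel
    simp only [hφ] at hle
    rw [hsplit, norm_add_sq_real, inner_add_right] at hle
    rw [real_inner_smul_left, inner_sub_left]
    nlinarith [norm_nonneg (z - u)]
  · rwa [inv_lt_iff_one_lt_mul₀ hc0, mul_comm]
  · rw [inv_smul_smul₀ hc0.ne', sub_sub_cancel_left, norm_neg]
    exact hnorm

/-- The horizon subgradients of a closed proper convex function are the horizontal normals to its
epigraph. -/
theorem mem_horizonSubdiff_iff [FiniteDimensional ℝ H] (hg : IsConvexFun g) (hp : IsProper g)
    (hlsc : LowerSemicontinuous g) (ht : g x ≠ ⊤) :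
    v ∈ horizonSubdiff g x ↔ WithLp.toLp 2 (v, (0 : ℝ)) ∈ normalCone (epi g) (graphPoint g x) := by
  constructor
  · rintro ⟨hb, -, u, w, l, hu, hgu, hw, hl0, hl, hlw⟩
    refine ⟨graphPoint_mem_epi ht, fun k => graphPoint g (u k),
      fun k => l k • WithLp.toLp 2 (w k, (-1 : ℝ)), tendsto_graphPoint hb ht hu hgu, ?_,
      fun k => smul_mem_regularNormalCone hg (hl0 k).le
        (mem_regularNormalCone_epi_of_mem_regularSubdiff (hw k))⟩
    have h1 : Tendsto (fun k => (l k • w k, l k * (-1))) atTop (𝓝 (v, (0 : ℝ))) := by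
      refine hlw.prodMk_nhds ?_
      simpa using hl.mul_const (-1)
    exact ((WithLp.prod_continuous_toLp 2 H ℝ).tendsto _).comp h1
  · intro h
    have hdom : ∀ z, g z ≠ ⊤ → inner ℝ v (z - x) ≤ 0 := fun z hz => by
      simpa using (mem_normalCone_epi_iff hg ht).1 h z (g z).toReal (EReal.le_coe_toReal hz)
    choose u w l hu hgu hw hl0 hl hlw using fun k : ℕ =>
      exists_regularSubdiff_of_horizontal_normal hp hlsc ht hdom (Nat.one_div_pos_of_nat (n := k))
    have hzero : Tendsto (fun k : ℕ => 1 / ((k : ℝ) + 1)) atTop (𝓝 0) :=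
      tendsto_one_div_add_atTop_nhds_zero_nat
    have hux : Tendsto u atTop (𝓝 x) := tendsto_iff_norm_sub_tendsto_zero.2 <|
      squeeze_zero (fun _ => norm_nonneg _) (fun k => (hu k).le) hzero
    refine ⟨hp.1 x, ht, u, w, l, hux, ?_, hw, hl0,
      squeeze_zero (fun k => (hl0 k).le) (fun k => (hl k).le) hzero,
      tendsto_iff_norm_sub_tendsto_zero.2 <|
        squeeze_zero (fun _ => norm_nonneg _) (fun k => (hlw k).le) hzero⟩
    refine tendsto_order.2 ⟨fun a ha => hux.eventually (hlsc x a ha), fun a ha => ?_⟩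
    exact Eventually.of_forall fun k => (hgu k).trans_lt ha

/-- The polar of the horizontal shadow of the tangent cone of the epigraph consists of the horizontal
normals. -/
theorem mem_normalCone_epi_zero_iff_domTangent (hg : IsConvexFun g) (ht : g x ≠ ⊤) :
    WithLp.toLp 2 (v, (0 : ℝ)) ∈ normalCone (epi g) (graphPoint g x) ↔
      ∀ u ∈ domTangent g x, inner ℝ v u ≤ 0 := by
  rw [mem_normalCone_iff_tangentCone hg (graphPoint_mem_epi ht)]
  constructor
  · rintro h u ⟨s, hs⟩
    simpa [WithLp.prod_inner_apply] using h _ hs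
  · intro h p hp
    have := h p.fst ⟨p.snd, hp⟩
    simpa [WithLp.prod_inner_apply] using this

theorem zero_mem_domTangent (hg : IsConvexFun g) (ht : g x ≠ ⊤) : (0 : H) ∈ domTangent g x := by
  refine ⟨0, ?_⟩
  have hp := graphPoint_mem_epi ht
  have h := sub_mem_tangentCone hg hp hp
  rwa [sub_self] at h

theorem add_mem_domTangent (hg : IsConvexFun g) {a b : H} (ha : a ∈ domTangent g x)
    (hb : b ∈ domTangent g x) : a + b ∈ domTangent g x := by
  obtain ⟨s, hs⟩ := ha
  obtain ⟨t, ht⟩ := hb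
  have h := add_mem_tangentCone hg hs ht
  rw [← WithLp.toLp_add, Prod.mk_add_mk] at h
  exact ⟨_, h⟩

theorem smul_mem_domTangent {c : ℝ} (hc : 0 < c) {a : H} (ha : a ∈ domTangent g x) :
    c • a ∈ domTangent g x := by
  obtain ⟨s, hs⟩ := ha
  have h := smul_mem_tangentCone hc hs
  rw [← WithLp.toLp_smul, Prod.smul_mk] at h
  exact ⟨_, h⟩

/-! ### Tangents to the epigraph and the subderivative -/

/-- If `(w, h)` is tangent to the epigraph, the difference quotients are frequently at most `h + 1`;
conversely, points where they are at most `M` give tangents `(w', M)` with `w'` near `w`, and the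
tangent cone is closed. -/
theorem domTangent_eq_effDom_subderiv (hg : IsConvexFun g) (hp : IsProper g) (ht : g x ≠ ⊤) :
    domTangent g x = effDom (subderiv g x) := by
  obtain ⟨r, hr⟩ : ∃ r : ℝ, g x = r := ⟨_, (EReal.coe_toReal ht (hp.1 x)).symm⟩
  have hgp : graphPoint g x = WithLp.toLp 2 (x, r) := by simp [graphPoint, hr]
  -- Difference quotients bounded by `M` are the same as points of the epigraph.
  have hquot : ∀ (t M : ℝ) (w : H), 0 < t →
      ((g (x + t • w) - g x) / (t : EReal) ≤ M ↔ g (x + t • w) ≤ (r + t * M : ℝ)) := by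
    intro t M w h0
    rw [EReal.div_le_iff_le_mul (EReal.coe_pos.2 h0) (EReal.coe_ne_top _), hr,
      EReal.sub_le_iff_le_add (Or.inl (EReal.coe_ne_bot _)) (Or.inl (EReal.coe_ne_top _)),
      ← EReal.coe_mul, ← EReal.coe_add, add_comm (t * M)]
  ext w
  constructor
  · rintro ⟨h, hw⟩
    refine lt_of_le_of_lt (b := ((h + 1 : ℝ) : EReal)) ?_ (EReal.coe_lt_top _)
    refine liminf_le_of_frequently_le' ?_
    rw [hgp] at hw
    rw [(((nhdsGT_basis (0 : ℝ)).prod Metric.nhds_basis_ball)).frequently_iff]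
    rintro ⟨b, ρ⟩ ⟨hb, hρ⟩
    obtain ⟨t, ⟨p, hp, hdist⟩, ht⟩ := (((mem_tangentCone_iff.1 hw).2 (min ρ 1)
      (lt_min hρ one_pos)).and (Ioo_mem_nhdsGT hb)).exists
    have ht0 : 0 < t := ht.1
    rw [dist_eq_norm, ← norm_neg, neg_sub] at hdist
    have h1 : ‖p.fst - (x + t • w)‖ < min ρ 1 * t := (WithLp.norm_fst_le _ _).trans_lt hdist
    have h2 : ‖p.snd - (r + t * h)‖ < min ρ 1 * t :=
      (WithLp.norm_snd_le _ _).trans_lt hdist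
    refine ⟨(t, t⁻¹ • (p.fst - x)), ⟨ht, ?_⟩, ?_⟩
    · rw [mem_ball_iff_norm]
      have h3 : t⁻¹ • (p.fst - x) - w = t⁻¹ • (p.fst - (x + t • w)) := by
        rw [← sub_sub, smul_sub _ (p.fst - x), inv_smul_smul₀ ht0.ne']
      rw [h3, norm_smul, norm_inv, Real.norm_of_nonneg ht0.le, inv_mul_lt_iff₀ ht0, mul_comm]
      exact h1.trans_le (by gcongr; exact min_le_left _ _)
    · rw [hquot _ _ _ ht0, smul_inv_smul₀ ht0.ne', add_sub_cancel]
      refine le_trans hp (EReal.coe_le_coe_iff.2 ?_)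
      have h3 := (abs_lt.1 (Real.norm_eq_abs _ ▸ h2)).2
      have h4 : min ρ 1 * t ≤ 1 * t := by gcongr; exact min_le_right _ _
      linarith
  · intro hw
    obtain ⟨M, hM, -⟩ := EReal.lt_iff_exists_real_btwn.1 (show subderiv g x w < ⊤ from hw)
    have hfreq := frequently_lt_of_liminf_lt (h := hM)
    refine ⟨M, ?_⟩
    refine isClosed_tangentCone.closure_subset (Metric.mem_closure_iff.2 fun ε hε => ?_)
    rw [(((nhdsGT_basis (0 : ℝ)).prod Metric.nhds_basis_ball)).frequently_iff] at hfreq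
    obtain ⟨⟨t, w'⟩, ⟨ht1, hw'⟩, hlt⟩ := hfreq (1, ε) ⟨one_pos, hε⟩
    have ht0 : 0 < t := ht1.1
    have hmem : WithLp.toLp 2 (x + t • w', r + t * M) ∈ epi g := (hquot t M w' ht0).1 hlt.le
    have h1 := smul_mem_tangentCone (inv_pos.2 ht0)
      (sub_mem_tangentCone hg (graphPoint_mem_epi ht) hmem)
    have h2 : t⁻¹ • (WithLp.toLp 2 (x + t • w', r + t * M) - graphPoint g x) =
        WithLp.toLp 2 (w', M) := by
      rw [hgp, ← WithLp.toLp_sub, ← WithLp.toLp_smul, Prod.mk_sub_mk, add_sub_cancel_left,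
        add_sub_cancel_left, Prod.smul_mk, inv_smul_smul₀ ht0.ne', smul_eq_mul,
        inv_mul_cancel_left₀ ht0.ne']
    rw [h2] at h1
    refine ⟨_, h1, ?_⟩
    rw [WithLp.prod_dist_eq_of_L2]
    have hw'' : dist w w' < ε := by rw [dist_comm]; exact hw'
    simpa [Real.sqrt_sq dist_nonneg] using hw''

end Epigraph

section Constraint

variable {X Y : Type*} [NormedAddCommGroup X] [InnerProductSpace ℝ X]
  [NormedAddCommGroup Y] [InnerProductSpace ℝ Y]
  {f : X → EReal} {A : X →ₗ[ℝ] Y} {b : Y} {x : X}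

/-! ### The function restricted to the affine set -/

theorem restr_of_mem {z : X} (hz : A z = b) : restr f A b z = f z := by
  have : z ∈ affSet A b := hz
  simp [restr, indicatorFun, this]

theorem restr_of_notMem (hp : IsProper f) {z : X} (hz : A z ≠ b) : restr f A b z = ⊤ := by
  have : z ∉ affSet A b := hz
  simp [restr, indicatorFun, this, EReal.add_top_of_ne_bot (hp.1 z)]

theorem restr_le_coe_iff (hp : IsProper f) {z : X} {τ : ℝ} :
    restr f A b z ≤ τ ↔ f z ≤ τ ∧ A z = b := by
  by_cases hz : A z = b
  · simp [restr_of_mem hz, hz]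
  · simp [restr_of_notMem hp hz, hz]

theorem epi_restr (hp : IsProper f) : epi (restr f A b) = epi f ∩ cylinder (affSet A b) :=
  Set.ext fun _ => restr_le_coe_iff hp

theorem graphPoint_restr (hx : A x = b) : graphPoint (restr f A b) x = graphPoint f x := by
  simp [graphPoint, restr_of_mem hx]

theorem isProper_restr (hp : IsProper f) (hx : A x = b) (ht : f x ≠ ⊤) :
    IsProper (restr f A b) := by
  refine ⟨fun z => ?_, x, by rwa [restr_of_mem hx]⟩
  by_cases hz : A z = b
  · rw [restr_of_mem hz]
    exact hp.1 z
  · simp [restr_of_notMem hp hz]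

theorem lowerSemicontinuous_restr [FiniteDimensional ℝ X] (hp : IsProper f)
    (hlsc : LowerSemicontinuous f) : LowerSemicontinuous (restr f A b) := by
  intro z y hy
  by_cases hz : A z = b
  · rw [restr_of_mem hz] at hy
    filter_upwards [hlsc z y hy] with z' hz'
    by_cases h : A z' = b
    · rwa [restr_of_mem h]
    · rw [restr_of_notMem hp h]
      exact hz'.trans_le le_top
  · have hopen : IsOpen {z' | A z' ≠ b} :=
      isOpen_ne_fun A.continuous_of_finiteDimensional continuous_const
    filter_upwards [hopen.mem_nhds hz] with z' hz'
    rw [restr_of_notMem hp hz']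
    rwa [restr_of_notMem hp hz] at hy

theorem convex_cylinder_affSet : Convex ℝ (cylinder (affSet A b)) := by
  intro p hp q hq s t _ _ hst
  have hp' : A p.fst = b := hp
  have hq' : A q.fst = b := hq
  change A (s • p.fst + t • q.fst) = b
  rw [map_add, map_smul, map_smul, hp', hq', ← add_smul, hst, one_smul]

theorem isConvexFun_restr (hp : IsProper f) (hf : IsConvexFun f) :
    IsConvexFun (restr f A b) := by
  unfold IsConvexFun
  rw [epi_restr hp]
  exact Convex.inter hf convex_cylinder_affSet

/-- The direction space `ker A × ℝ` of the cylinder over `affSet A b`. -/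
def cylinderDirection (A : X →ₗ[ℝ] Y) : Submodule ℝ (WithLp 2 (X × ℝ)) :=
  LinearMap.ker (A ∘ₗ LinearMap.fst ℝ X ℝ ∘ₗ (WithLp.linearEquiv 2 ℝ (X × ℝ)).toLinearMap)

theorem mem_cylinderDirection_iff {p : WithLp 2 (X × ℝ)} :
    p ∈ cylinderDirection A ↔ A p.fst = 0 := Iff.rfl

/-! ### Surjectivity of the constraint map -/

theorem add_ker_eq_univ_iff_image_eq_univ (hA : Function.Surjective A) {S : Set X} :
    S + (LinearMap.ker A : Set X) = Set.univ ↔ A '' S = Set.univ := by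
  simp only [Set.eq_univ_iff_forall]
  constructor
  · intro h y
    obtain ⟨z, rfl⟩ := hA y
    obtain ⟨s, hs, l, hl, rfl⟩ := h z
    have hl' : A l = 0 := hl
    exact ⟨s, hs, by rw [map_add, hl', add_zero]⟩
  · intro h z
    obtain ⟨s, hs, hsz⟩ := h (A z)
    refine ⟨s, hs, z - s, ?_, add_sub_cancel s z⟩
    change A (z - s) = 0
    rw [map_sub, hsz, sub_self]

theorem rcq_of_nondegeneracy (hf : IsConvexFun f) (ht : f x ≠ ⊤) (h : Nondegeneracy f A x) :
    RCQ f A x := by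
  have hlin : (lin (domTangent f x) : Set X) ⊆ domTangent f x :=
    (lin_isGreatest _ (zero_mem_domTangent hf ht) fun _ ha _ hb => add_mem_domTangent hf ha hb).1
  refine Set.univ_subset_iff.1 ?_
  rw [← h]
  exact Set.add_subset_add_right hlin

/-! ### Normals to the cylinder -/

variable [FiniteDimensional ℝ X] [FiniteDimensional ℝ Y]

theorem mem_adjRange_iff {v : X} :
    v ∈ adjRange A ↔ ∀ l ∈ LinearMap.ker A, inner ℝ v l = 0 := by
  rw [adjRange, ← LinearMap.orthogonal_ker, Submodule.mem_orthogonal']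

theorem toLp_mem_orthogonal_cylinderDirection_iff {v : X} {s : ℝ} :
    WithLp.toLp 2 (v, s) ∈ (cylinderDirection A)ᗮ ↔ v ∈ adjRange A ∧ s = 0 := by
  rw [Submodule.mem_orthogonal', mem_adjRange_iff]
  constructor
  · intro h
    refine ⟨fun l hl => ?_, ?_⟩
    · simpa [WithLp.prod_inner_apply] using
        h (WithLp.toLp 2 (l, 0)) (mem_cylinderDirection_iff.2 hl)
    · simpa [WithLp.prod_inner_apply] using
        h (WithLp.toLp 2 (0, 1)) (mem_cylinderDirection_iff.2 (map_zero A))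
  · rintro ⟨hv, rfl⟩ p hp
    simpa [WithLp.prod_inner_apply] using hv p.fst hp

omit [FiniteDimensional ℝ X] [FiniteDimensional ℝ Y] in
theorem mem_normalCone_cylinder_iff (hx : A x = b) {d : WithLp 2 (X × ℝ)} :
    d ∈ normalCone (cylinder (affSet A b)) (graphPoint f x) ↔ d ∈ (cylinderDirection A)ᗮ := by
  have hmem : graphPoint f x ∈ cylinder (affSet A b) := hx
  rw [mem_normalCone_iff convex_cylinder_affSet hmem, Submodule.mem_orthogonal']
  constructor
  · intro h
    have hle : ∀ l ∈ cylinderDirection A, inner ℝ d l ≤ 0 := fun l hl => by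
      have : graphPoint f x + l ∈ cylinder (affSet A b) := by
        change A (x + l.fst) = b
        rw [map_add, hx, mem_cylinderDirection_iff.1 hl, add_zero]
      simpa using h _ this
    intro l hl
    refine le_antisymm (hle l hl) ?_
    have h' := hle (-l) (Submodule.neg_mem _ hl)
    rw [inner_neg_right] at h'
    linarith
  · intro h z hz
    refine (h _ (mem_cylinderDirection_iff.2 ?_)).le
    change A (z.fst - x) = 0
    rw [map_sub, hx, sub_eq_zero]
    exact hz

theorem toLp_mem_normalCone_cylinder_iff (hx : A x = b) {v : X} {s : ℝ} :
    WithLp.toLp 2 (v, s) ∈ normalCone (cylinder (affSet A b)) (graphPoint f x) ↔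
      v ∈ adjRange A ∧ s = 0 := by
  rw [mem_normalCone_cylinder_iff hx, toLp_mem_orthogonal_cylinderDirection_iff]

/-! ### Sum rules -/

theorem mem_add_adjRange_iff {S : Set X} {v : X} :
    v ∈ S + (adjRange A : Set X) ↔ ∃ a ∈ adjRange A, v - a ∈ S := by
  rw [Set.mem_add]
  constructor
  · rintro ⟨s, hs, a, ha, rfl⟩
    exact ⟨a, ha, by simpa using hs⟩
  · rintro ⟨a, ha, hs⟩
    exact ⟨v - a, hs, a, ha, by simp⟩

theorem mem_normalCone_epi_add_cylinder_iff (hx : A x = b) {v : X} {s : ℝ} :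
    WithLp.toLp 2 (v, s) ∈ normalCone (epi f) (graphPoint f x) +
        normalCone (cylinder (affSet A b)) (graphPoint f x) ↔
      ∃ a ∈ adjRange A, WithLp.toLp 2 (v - a, s) ∈ normalCone (epi f) (graphPoint f x) := by
  rw [Set.mem_add]
  constructor
  · rintro ⟨p, hp, q, hq, hpq⟩
    obtain ⟨hq1, hq2⟩ := (toLp_mem_normalCone_cylinder_iff hx (v := q.fst) (s := q.snd)).1 hq
    refine ⟨q.fst, hq1, ?_⟩
    have h1 : v - q.fst = p.fst := by
      have : p.fst + q.fst = v := congrArg WithLp.fst hpq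
      rw [← this, add_sub_cancel_right]
    have h2 : s = p.snd := by
      have : p.snd + q.snd = s := congrArg WithLp.snd hpq
      rw [← this, hq2, add_zero]
    rw [h1, h2]
    exact hp
  · rintro ⟨a, ha, h⟩
    refine ⟨_, h, WithLp.toLp 2 (a, 0), (toLp_mem_normalCone_cylinder_iff hx).2 ⟨ha, rfl⟩, ?_⟩
    rw [← WithLp.toLp_add, Prod.mk_add_mk, sub_add_cancel, add_zero]

theorem epiCHIP_iff (hx : A x = b) :
    EpiCHIP f A b x ↔ ∀ (v : X) (s : ℝ),
      WithLp.toLp 2 (v, s) ∈ normalCone (epi (restr f A b)) (graphPoint f x) ↔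
        ∃ a ∈ adjRange A, WithLp.toLp 2 (v - a, s) ∈ normalCone (epi f) (graphPoint f x) := by
  rw [EpiCHIP, Set.ext_iff]
  constructor
  · intro h v s
    rw [h, mem_normalCone_epi_add_cylinder_iff hx]
  · intro h p
    exact (h p.fst p.snd).trans (mem_normalCone_epi_add_cylinder_iff hx).symm

/-- The normals of slope `-1` are the subgradients and the horizontal ones the horizon subgradients;
by positive homogeneity these two slices determine the normal cone of an epigraph. -/
theorem rssr_iff_epiCHIP (hp : IsProper f) (hlsc : LowerSemicontinuous f) (hf : IsConvexFun f)
    (hx : A x = b) (ht : f x ≠ ⊤) : RSSR f A b x ↔ EpiCHIP f A b x := by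
  have hp' := isProper_restr hp hx ht
  have hlsc' := lowerSemicontinuous_restr (A := A) (b := b) hp hlsc
  have hf' := isConvexFun_restr (A := A) (b := b) hp hf
  have ht' : restr f A b x ≠ ⊤ := by rwa [restr_of_mem hx]
  rw [epiCHIP_iff hx, RSSR, Set.ext_iff, Set.ext_iff]
  simp only [mem_add_adjRange_iff, mem_subdiff_iff hf hp ht, mem_subdiff_iff hf' hp' ht',
    mem_horizonSubdiff_iff hf hp hlsc ht, mem_horizonSubdiff_iff hf' hp' hlsc' ht',
    graphPoint_restr hx]
  refine ⟨fun ⟨h1, h0⟩ v s => ?_, fun h => ⟨fun v => h v _, fun v => h v _⟩⟩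
  -- Rescale to slope `-1` when `s < 0`; for `s > 0` both sides are empty.
  rcases lt_trichotomy s 0 with hs | rfl | hs
  · have hs' : 0 < -s := neg_pos.2 hs
    have hscale : ∀ (g : X → EReal), IsConvexFun g → ∀ w : X,
        WithLp.toLp 2 (w, s) ∈ normalCone (epi g) (graphPoint f x) ↔
          WithLp.toLp 2 ((-s)⁻¹ • w, (-1 : ℝ)) ∈ normalCone (epi g) (graphPoint f x) := by
      intro g hg w
      constructor
      · intro h
        have := smul_mem_normalCone hg (inv_nonneg.2 hs'.le) h
        rwa [← WithLp.toLp_smul, Prod.smul_mk, smul_eq_mul, inv_neg, neg_mul,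
          inv_mul_cancel₀ hs.ne, ← inv_neg] at this
      · intro h
        have := smul_mem_normalCone hg hs'.le h
        rwa [← WithLp.toLp_smul, Prod.smul_mk, smul_inv_smul₀ hs'.ne', smul_eq_mul,
          neg_mul_neg, mul_one] at this
    rw [hscale _ hf', h1]
    constructor
    · rintro ⟨a, ha, h⟩
      refine ⟨(-s) • a, Submodule.smul_mem _ _ ha, (hscale _ hf _).2 ?_⟩
      rwa [smul_sub, inv_smul_smul₀ hs'.ne']
    · rintro ⟨a, ha, h⟩
      refine ⟨(-s)⁻¹ • a, Submodule.smul_mem _ _ ha, ?_⟩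
      rw [← smul_sub]
      exact (hscale _ hf _).1 h
  · exact h0 v
  · constructor
    · intro h
      rw [← graphPoint_restr hx] at h
      exact absurd (nonpos_of_mem_normalCone_epi hf' ht' h) hs.not_ge
    · rintro ⟨a, -, h⟩
      exact absurd (nonpos_of_mem_normalCone_epi hf ht h) hs.not_ge

/-! ### Qualification conditions -/

omit [FiniteDimensional ℝ X] [FiniteDimensional ℝ Y] in
theorem epiTransversality_iff (hf : IsConvexFun f) (hx : A x = b) (ht : f x ≠ ⊤) :
    EpiTransversality f A b x ↔
      ∀ d ∈ normalCone (epi f) (graphPoint f x), d ∈ (cylinderDirection A)ᗮ → d = 0 := by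
  rw [EpiTransversality, inter_eq_singleton_zero_iff (zero_mem_normalCone hf (graphPoint_mem_epi ht))
    ((mem_normalCone_cylinder_iff hx).2 (Submodule.zero_mem _))]
  simp only [mem_normalCone_cylinder_iff hx]

theorem horizonQC_iff (hp : IsProper f) (hlsc : LowerSemicontinuous f) (hf : IsConvexFun f)
    (ht : f x ≠ ⊤) :
    HorizonQC f A x ↔ ∀ v : X,
      WithLp.toLp 2 (v, (0 : ℝ)) ∈ normalCone (epi f) (graphPoint f x) → v ∈ adjRange A → v = 0 := by
  rw [HorizonQC, inter_eq_singleton_zero_iff _ (Submodule.zero_mem _)]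
  · simp only [mem_horizonSubdiff_iff hf hp hlsc ht]
    rfl
  · rw [mem_horizonSubdiff_iff hf hp hlsc ht]
    exact zero_mem_normalCone hf (graphPoint_mem_epi ht)

theorem epiTransversality_iff_horizonQC (hp : IsProper f) (hlsc : LowerSemicontinuous f)
    (hf : IsConvexFun f) (hx : A x = b) (ht : f x ≠ ⊤) :
    EpiTransversality f A b x ↔ HorizonQC f A x := by
  rw [epiTransversality_iff hf hx ht, horizonQC_iff hp hlsc hf ht]
  constructor
  · intro h v hv hvA
    exact congrArg WithLp.fst
      (h _ hv (toLp_mem_orthogonal_cylinderDirection_iff.2 ⟨hvA, rfl⟩))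
  · intro h d hd hdL
    obtain ⟨h1, h2⟩ :=
      (toLp_mem_orthogonal_cylinderDirection_iff (v := d.fst) (s := d.snd)).1 hdL
    have hd' : d = WithLp.toLp 2 (d.fst, (0 : ℝ)) :=
      congrArg (fun s => WithLp.toLp 2 (d.fst, s)) h2
    rw [hd'] at hd
    rw [hd', h _ hd h1]
    rfl

omit [FiniteDimensional ℝ Y] in
theorem epiCHIP_of_epiTransversality (hp : IsProper f) (hlsc : LowerSemicontinuous f)
    (hf : IsConvexFun f) (hx : A x = b) (ht : f x ≠ ⊤) (h : EpiTransversality f A b x) :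
    EpiCHIP f A b x := by
  have hmem : graphPoint f x ∈ epi f := graphPoint_mem_epi ht
  have hdir : ∀ z : WithLp 2 (X × ℝ),
      z - graphPoint f x ∈ cylinderDirection A ↔ z ∈ cylinder (affSet A b) := fun z => by
    change A (z.fst - x) = 0 ↔ A z.fst = b
    rw [map_sub, hx, sub_eq_zero]
  have hinter : ∀ n : WithLp 2 (X × ℝ),
      n ∈ normalCone (epi (restr f A b)) (graphPoint f x) ↔
        ∀ z ∈ epi f, z - graphPoint f x ∈ cylinderDirection A →
          inner ℝ n (z - graphPoint f x) ≤ 0 := fun n => by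
    rw [mem_normalCone_iff (isConvexFun_restr hp hf) (by rw [epi_restr hp]; exact ⟨hmem, hx⟩),
      epi_restr hp]
    simp only [hdir, Set.mem_inter_iff, and_imp]
  refine Set.Subset.antisymm (fun n hn => ?_) ?_
  · obtain ⟨η, hη, hnη⟩ := exists_orthogonal_sub_mem_normalCone hf (isClosed_epi hlsc) hmem _
      ((epiTransversality_iff hf hx ht).1 h) ((hinter n).1 hn)
    exact ⟨_, hnη, η, (mem_normalCone_cylinder_iff hx).2 hη, sub_add_cancel _ _⟩
  · rintro _ ⟨d, hd, η, hη, rfl⟩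
    refine (hinter _).2 fun z hz hzL => ?_
    rw [inner_add_left, Submodule.inner_left_of_mem_orthogonal hzL
      ((mem_normalCone_cylinder_iff hx).1 hη), add_zero]
    exact (mem_normalCone_iff hf hmem).1 hd z hz

omit [FiniteDimensional ℝ Y] in
theorem epiTransversality_iff_tangent (hf : IsConvexFun f) (hx : A x = b) (ht : f x ≠ ⊤) :
    EpiTransversality f A b x ↔ EpiTransversalityTangent f A b x := by
  have hmem : graphPoint f x ∈ epi f := graphPoint_mem_epi ht
  have hmem' : graphPoint f x ∈ cylinder (affSet A b) := hx
  have hcyl : Convex ℝ (cylinder (affSet A b)) := convex_cylinder_affSet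
  have h1 : 0 ∈ tangentCone (epi f) (graphPoint f x) := by
    simpa using sub_mem_tangentCone hf hmem hmem
  have h2 : 0 ∈ tangentCone (cylinder (affSet A b)) (graphPoint f x) := by
    simpa using sub_mem_tangentCone hcyl hmem' hmem'
  rw [EpiTransversalityTangent, eq_univ_iff_polar_eq_zero]
  · simp only [forall_mem_add_inner_nonpos_iff h1 h2, ← mem_normalCone_iff_tangentCone hf hmem,
      ← mem_normalCone_iff_tangentCone hcyl hmem', and_imp]
    rw [EpiTransversality, inter_eq_singleton_zero_iff (zero_mem_normalCone hf hmem)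
      (zero_mem_normalCone hcyl hmem')]
  · exact ⟨0, h1, 0, h2, add_zero 0⟩
  · rintro _ ⟨a, ha, a', ha', rfl⟩ _ ⟨c, hc, c', hc', rfl⟩
    exact ⟨_, add_mem_tangentCone hf ha hc, _, add_mem_tangentCone hcyl ha' hc', by
      simp only; abel⟩
  · rintro c hc _ ⟨a, ha, a', ha', rfl⟩
    exact ⟨_, smul_mem_tangentCone hc ha, _, smul_mem_tangentCone hc ha', (smul_add _ _ _).symm⟩

theorem horizonQC_iff_rcq (hp : IsProper f) (hlsc : LowerSemicontinuous f) (hf : IsConvexFun f)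
    (ht : f x ≠ ⊤) : HorizonQC f A x ↔ RCQ f A x := by
  have h0 := zero_mem_domTangent hf ht
  have hker : (0 : X) ∈ (LinearMap.ker A : Set X) := Submodule.zero_mem _
  have hpolar : ∀ v : X, (∀ l ∈ (LinearMap.ker A : Set X), inner ℝ v l ≤ 0) ↔ v ∈ adjRange A := by
    intro v
    rw [mem_adjRange_iff]
    refine ⟨fun h l hl => le_antisymm (h l hl) ?_, fun h l hl => (h l hl).le⟩
    simpa using h (-l) (Submodule.neg_mem _ hl)
  rw [RCQ, horizonQC_iff hp hlsc hf ht, eq_univ_iff_polar_eq_zero]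
  · simp only [forall_mem_add_inner_nonpos_iff h0 hker, hpolar,
      mem_normalCone_epi_zero_iff_domTangent hf ht, and_imp]
  · exact ⟨0, h0, 0, hker, add_zero 0⟩
  · rintro _ ⟨a, ha, a', ha', rfl⟩ _ ⟨c, hc, c', hc', rfl⟩
    exact ⟨_, add_mem_domTangent hf ha hc, _, Submodule.add_mem _ ha' hc', by simp only; abel⟩
  · rintro c hc _ ⟨a, ha, a', ha', rfl⟩
    exact ⟨_, smul_mem_domTangent hc ha, _, Submodule.smul_mem _ c ha', (smul_add _ _ _).symm⟩

end Constraint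

end RegHierarchy

theorem mainTheorem5 {X Y : Type*}
    [NormedAddCommGroup X] [InnerProductSpace ℝ X] [FiniteDimensional ℝ X]
    [NormedAddCommGroup Y] [InnerProductSpace ℝ Y] [FiniteDimensional ℝ Y]
    (f : X → EReal) (hproper : RegHierarchy.IsProper f) (hclosed : LowerSemicontinuous f)
    (hconv : RegHierarchy.IsConvexFun f)
    (A : X →ₗ[ℝ] Y) (hA : Function.Surjective A) (b : Y)
    (x : X) (hx : x ∈ RegHierarchy.feasible f A b) :
    (RegHierarchy.RSSR f A b x → RegHierarchy.SSR f A b x) ∧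
    (RegHierarchy.RSSR f A b x ↔ RegHierarchy.EpiCHIP f A b x) ∧
    (RegHierarchy.EpiTransversality f A b x → RegHierarchy.EpiCHIP f A b x) ∧
    (RegHierarchy.EpiTransversality f A b x ↔ RegHierarchy.EpiTransversalityTangent f A b x) ∧
    (RegHierarchy.EpiTransversality f A b x ↔ RegHierarchy.HorizonQC f A x) ∧
    (RegHierarchy.HorizonQC f A x ↔ RegHierarchy.RCQ f A x) ∧
    (RegHierarchy.RCQ f A x ↔ RegHierarchy.RCQImage f A x) ∧
    RegHierarchy.domTangent f x = RegHierarchy.effDom (RegHierarchy.subderiv f x) ∧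
    (RegHierarchy.Nondegeneracy f A x → RegHierarchy.RCQ f A x) ∧
    (RegHierarchy.Nondegeneracy f A x ↔ RegHierarchy.NondegeneracyImage f A x) := by
  have hb : A x = b := hx.1
  have ht : f x ≠ ⊤ := ne_of_lt hx.2
  exact ⟨And.left,
    RegHierarchy.rssr_iff_epiCHIP hproper hclosed hconv hb ht,
    RegHierarchy.epiCHIP_of_epiTransversality hproper hclosed hconv hb ht,
    RegHierarchy.epiTransversality_iff_tangent hconv hb ht,
    RegHierarchy.epiTransversality_iff_horizonQC hproper hclosed hconv hb ht,
    RegHierarchy.horizonQC_iff_rcq hproper hclosed hconv ht,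
    RegHierarchy.add_ker_eq_univ_iff_image_eq_univ hA,
    RegHierarchy.domTangent_eq_effDom_subderiv hconv hproper ht,
    RegHierarchy.rcq_of_nondegeneracy hconv ht,
    RegHierarchy.add_ker_eq_univ_iff_image_eq_univ hA⟩
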